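/- Let $\omega_1$ be the first uncountable ordinal with its order topology and let $L$ be the set of all limit ordinals $0<\alpha<\omega_1$; for $k\in\omega$ put $L+k=\{\alpha+k:\alpha\in L\}$. Kulesza's space is the subspace $$Z=\{(a_0,a_1,\dots)\in\omega_1^{\omega}:\ a_0\notin L,\ a_k\in L \text{ for at most one } k,\ \text{and if } a_k\in L \text{ then } a_{k+1}=a_k+k \text{ and } a_{k+i}\in L+k \text{ for all } i\ge 2\}$$ of the topological product $\omega_1^\omega$. Then $Z$ is metrizable and $\operatorname{ind} Z=0$, where $\operatorname{ind}$ is the small inductive dimension, and the following hold. (i) If $\{U_n:n\in\omega\}$ is a countable base, consisting of open subsets of $Z\times Z$, of a uniformity on $Z$ that generates the topology of $Z$, then some $U_m$ is not closed in $Z\times Z$. (ii) $Z$ cannot be embedded in any metrizable topological group $G$ with $\operatorname{ind} G=0$; that is, no map from $Z$ to such a group $G$ is a homeomorphism onto its image. -/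

import Mathlib

open Topology TopologicalSpace

/-- The set of countable ordinals, with the subspace topology of the ordinals; since it is an
initial segment of the ordinals, this is its own order topology. -/
abbrev OmegaOne : Type 1 := Set.Iio (Ordinal.omega.{0} 1)

/-- The set `L` of limit ordinals below `ω₁` (zero is not a limit ordinal). -/
def limitSet : Set OmegaOne := {α | Order.IsSuccLimit (α : Ordinal.{0})}

/-- The translate `L + k` of the set of limit ordinals below `ω₁`. -/
def limitSetAdd (k : ℕ) : Set OmegaOne :=
  {β | ∃ α ∈ limitSet, (β : Ordinal.{0}) = (α : Ordinal.{0}) + (k : Ordinal.{0})}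

/-- Kulesza's set of sequences: the initial term is not a limit, at most one term is a limit, and
if `a k` is a limit, then `a (k + 1) = a k + k` and `a (k + i) ∈ L + k` for all `i ≥ 2`. -/
def kuleszaSet : Set (ℕ → OmegaOne) :=
  {a | a 0 ∉ limitSet ∧
    {k : ℕ | a k ∈ limitSet}.Subsingleton ∧
    ∀ k : ℕ, a k ∈ limitSet →
      (a (k + 1) : Ordinal.{0}) = (a k : Ordinal.{0}) + (k : Ordinal.{0}) ∧
      ∀ i : ℕ, 2 ≤ i → a (k + i) ∈ limitSetAdd k}

/-- Kulesza's space `Z`, a subspace of the topological product of countably many copies of `ω₁`. -/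
abbrev KuleszaSpace : Type 1 := kuleszaSet

/-- The subspace topology of Kulesza's space, under a name of its own. -/
abbrev kuleszaTopology : TopologicalSpace KuleszaSpace := instTopologicalSpaceSubtype

open Set Filter

/-! ### Countable ordinals: topology, ladders, pressing down. -/

namespace OmegaOne

/-! Metrizability: a limit term `z k` is recorded by the next term `z k + k`, and all later terms
lie in `L + k`, so they reveal the place `k`. Hence two points with early limit terms whose basic
neighbourhoods meet share an initial segment (`BasicNear.agree`), which makes a countable family of
entourages compose (`entourage_comp`).

Both negative statements follow from `not_forall_isClopen`: countably many clopen sets never meet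
exactly in the diagonal. A set `V` is large at a finite string of pairs of non-limits if a
well-founded tree above it, branching cofinally by equal pairs `(u, u)`, has all extensions of its
leaves in `V`. For clopen `V`, a pair of points sharing the limit `a` at place `n` has a
neighbourhood inside `V` or `Vᶜ`, reaching down to some `b < a`. By pressing down, one `b` and one
side serve unboundedly many `a` (`exists_large`), so that side is large after every `(v, v')` above
`b`, even if `v ≠ v'`. At diagonal strings, and wherever `V` is large, `Vᶜ` is not large, so the
side is `V`. Starting on the diagonal, splitting once into `v ≠ v'` and then keeping all the sets
large yields a pair of distinct points in every set. -/

theorem add_one_lt {a : Ordinal.{0}} (ha : a < Ordinal.omega 1) : a + 1 < Ordinal.omega 1 :=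
  (Cardinal.isSuccLimit_omega 1).add_one_lt ha

/-- The ordinal `a + k`, for a countable ordinal `a` and a natural number `k`. -/
def addNat (a : OmegaOne) (k : ℕ) : OmegaOne :=
  ⟨(a : Ordinal.{0}) + (k : Ordinal.{0}), by
    induction k with
    | zero => simp
    | succ k ih =>
      rw [mem_Iio, Nat.cast_succ, ← add_assoc]
      exact add_one_lt ih⟩

instance : OrderBot OmegaOne where
  bot := ⟨0, Ordinal.omega_pos 1⟩
  bot_le a := Subtype.coe_le_coe.1 (zero_le (a := (a : Ordinal.{0})))

theorem lt_addNat_one (a : OmegaOne) : a < addNat a 1 := by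
  rw [← Subtype.coe_lt_coe]
  simp [addNat]

theorem le_addNat (a : OmegaOne) (k : ℕ) : a ≤ addNat a k := by
  rw [← Subtype.coe_le_coe]
  simp [addNat]

instance : NoMaxOrder OmegaOne := ⟨fun a => ⟨_, lt_addNat_one a⟩⟩

theorem exists_gt_of_countable {ι : Type*} [Countable ι] (f : ι → OmegaOne) :
    ∃ b : OmegaOne, ∀ i, f i < b := by
  rcases isEmpty_or_nonempty ι with hι | hι
  · exact ⟨⊥, fun i => (hι.false i).elim⟩
  obtain ⟨e, he⟩ := exists_surjective_nat ι
  have hlt : (⨆ n, (f (e n) : Ordinal.{0})) < Ordinal.omega 1 :=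
    Ordinal.iSup_lt_omega_one fun n => (f (e n)).2
  refine ⟨addNat ⟨_, hlt⟩ 1, fun i => lt_of_le_of_lt ?_ (lt_addNat_one _)⟩
  obtain ⟨n, rfl⟩ := he i
  exact Subtype.coe_le_coe.1 (le_ciSup (f := fun n => (f (e n) : Ordinal.{0}))
    Ordinal.bddAbove_of_small n)

theorem countable_Iio (a : OmegaOne) : (Iio a).Countable := by
  have : (Iio (a : Ordinal.{0})).Countable := by
    rw [← Cardinal.le_aleph0_iff_set_countable, Cardinal.mk_Iio_ordinal,
      Cardinal.lift_le_aleph0, ← Cardinal.lt_aleph_one_iff]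
    exact Cardinal.lt_omega_iff_card_lt.1 a.2
  exact (this.preimage Subtype.val_injective).mono fun b hb => hb

theorem countable_Iic (a : OmegaOne) : (Iic a).Countable := by
  rw [← Iio_insert]
  exact (countable_Iio a).insert a

theorem nhds_eq_pure {a : OmegaOne} (ha : a ∉ limitSet) : 𝓝 a = pure a := by
  rw [nhds_subtype_eq_comap, SuccOrder.nhds_eq_pure.2 ha, ← principal_singleton, comap_principal,
    ← principal_singleton]
  congr 1
  ext b
  simp [Subtype.ext_iff]

theorem hasBasis_nhds {a : OmegaOne} (ha : a ∈ limitSet) :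
    (𝓝 a).HasBasis (· < a) (Ioc · a) := by
  have h := (SuccOrder.hasBasis_nhds_Ioc_of_exists_lt
    (not_isMin_iff.1 (Order.IsSuccLimit.not_isMin ha))).comap (Subtype.val : OmegaOne → Ordinal.{0})
  rw [nhds_subtype_eq_comap]
  refine h.to_hasBasis (fun b hb => ⟨⟨b, hb.trans a.2⟩, hb, fun c hc => hc⟩)
    fun b hb => ⟨b, hb, fun c hc => hc⟩

theorem Ioc_mem_nhds {a b : OmegaOne} (hab : b < a) : Ioc b a ∈ 𝓝 a := by
  by_cases ha : a ∈ limitSet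
  · exact (hasBasis_nhds ha).mem_of_mem hab
  · rw [nhds_eq_pure ha]
    exact ⟨hab, le_rfl⟩

theorem isClopen_Ioc (b a : OmegaOne) : IsClopen (Ioc b a) := by
  refine ⟨?_, isOpen_iff_mem_nhds.2 fun c hc =>
    mem_of_superset (Ioc_mem_nhds hc.1) (Ioc_subset_Ioc_right hc.2)⟩
  have : Ioc b a = Iic a \ Iic b := by ext; simp [and_comm]
  have hb : IsOpen (Iic b) := isOpen_iff_mem_nhds.2 fun c hc => by
    by_cases h : c ∈ limitSet
    · obtain ⟨d, hd⟩ := not_isMin_iff.1 (Order.IsSuccLimit.not_isMin h)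
      exact mem_of_superset (Ioc_mem_nhds (b := ⟨d, hd.trans c.2⟩) hd) fun e he => he.2.trans hc
    · rw [nhds_eq_pure h]
      exact hc
  rw [this, Set.sdiff_eq]
  exact isClosed_Iic.inter hb.isClosed_compl

theorem isClopen_singleton {a : OmegaOne} (ha : a ∉ limitSet) : IsClopen {a} :=
  ⟨isClosed_singleton, isOpen_iff_mem_nhds.2 fun b hb => by
    rw [mem_singleton_iff.1 hb, nhds_eq_pure ha]; rfl⟩

theorem bot_notMem_limitSet : (⊥ : OmegaOne) ∉ limitSet := fun h => Order.IsSuccLimit.not_isMin h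
  (by rw [isMin_iff_eq_bot]; rfl)

theorem addNat_succ_notMem_limitSet (a : OmegaOne) (k : ℕ) :
    addNat a (k + 1) ∉ limitSet := by
  intro h
  change Order.IsSuccLimit ((a : Ordinal.{0}) + ((k + 1 : ℕ) : Ordinal.{0})) at h
  rw [Nat.cast_succ, ← add_assoc] at h
  exact lt_irrefl _ (h.add_one_lt (Order.lt_add_one_iff.2 le_rfl))

/-- Take the supremum of the iterates of a strictly increasing step that also exceeds `g`. -/
theorem exists_limit_gt_of_seq (g : OmegaOne → OmegaOne) (b : OmegaOne) :
    ∃ a ∈ limitSet, b < a ∧ ∀ c < a, ∃ d, c ≤ d ∧ d < a ∧ g d < a := by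
  have hs : ∀ c, ∃ d, c < d ∧ g c < d := fun c => by
    obtain ⟨d, hd⟩ := exists_gt (max c (g c))
    exact ⟨d, max_lt_iff.1 hd⟩
  choose s hs hgs using hs
  let β : ℕ → OmegaOne := fun n => s^[n] b
  have hβ : ∀ n, β (n + 1) = s (β n) := fun n => Function.iterate_succ_apply' s n b
  let a : OmegaOne := ⟨⨆ n, (β n : Ordinal.{0}), Ordinal.iSup_lt_omega_one fun n => (β n).2⟩
  have hle : ∀ n, β n ≤ a := fun n => Subtype.coe_le_coe.1
    (le_ciSup (f := fun n => (β n : Ordinal.{0})) Ordinal.bddAbove_of_small n)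
  have hlt : ∀ n, β n < a := fun n => (hs _).trans_le (hβ n ▸ hle (n + 1))
  have hex : ∀ c : Ordinal.{0}, c < a → ∃ n, c < β n := fun c hc =>
    exists_lt_of_lt_ciSup hc
  refine ⟨a, ⟨fun h => ?_, ?_⟩, hlt 0, fun c hc => ?_⟩
  · exact not_lt.2 (h (b := (b : Ordinal.{0})) (hlt 0).le) (hlt 0)
  · refine Order.isSuccPrelimit_of_succ_lt fun c hc => ?_
    obtain ⟨n, hn⟩ := hex c hc
    exact (Order.succ_le_of_lt hn).trans_lt (hlt n)
  · obtain ⟨n, hn⟩ := hex c hc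
    exact ⟨β n, le_of_lt (Subtype.coe_lt_coe.1 hn), hlt n, (hgs _).trans_le (hβ n ▸ hle (n + 1))⟩

theorem mem_limitSetAdd {a : OmegaOne} {k : ℕ} :
    a ∈ limitSetAdd k ↔ ∃ b ∈ limitSet, a = addNat b k := by
  simp [limitSetAdd, addNat, Subtype.ext_iff]

/-- This is the decoding step: a term in `L + k` determines `k` and its limit part. -/
theorem addNat_injective {a b : OmegaOne} (ha : a ∈ limitSet) (hb : b ∈ limitSet) {k j : ℕ}
    (h : addNat a k = addNat b j) : a = b ∧ k = j := by
  have h' : (a : Ordinal.{0}) + k = b + j := congrArg Subtype.val h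
  have key : ∀ {a b : Ordinal.{0}} {k j : ℕ}, Order.IsSuccLimit b → a + k = b + j → b ≤ a := by
    intro a b k j hb h
    by_contra! hlt
    have : a + k < b := by
      clear h
      induction k with
      | zero => simpa
      | succ k ih => rw [Nat.cast_succ, ← add_assoc]; exact hb.add_one_lt ih
    exact absurd (h ▸ this) (not_lt.2 (by simp))
  have hab : a = b := Subtype.ext (le_antisymm (key ha h'.symm) (key hb h'))
  subst hab
  exact ⟨rfl, by simpa using h'⟩

theorem exists_ladder (a : OmegaOne) (ha : a ∈ limitSet) :
    ∃ γ : ℕ → OmegaOne, Monotone γ ∧ (∀ n, γ n < a) ∧ ∀ b < a, ∃ n, b ≤ γ n := by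
  have h0 : (⊥ : OmegaOne) < a := bot_lt_iff_ne_bot.2 fun h => bot_notMem_limitSet (h ▸ ha)
  have : Nonempty (Iio a) := ⟨⟨⊥, h0⟩⟩
  have := (countable_Iio a).to_subtype
  obtain ⟨e, he⟩ := exists_surjective_nat (Iio a)
  refine ⟨partialSups fun n => (e n : OmegaOne), (partialSups _).monotone, fun n => ?_,
    fun b hb => ?_⟩
  · rw [partialSups_apply, Finset.sup'_lt_iff]
    exact fun i _ => (e i).2
  · obtain ⟨n, hn⟩ := he ⟨b, hb⟩
    exact ⟨n, by simpa [hn] using le_partialSups (fun n => (e n : OmegaOne)) n⟩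

/-- A form of the pressing down lemma: a choice of an ordinal below each countable limit
ordinal, and of a label from a countable set, is constant on an unbounded set. -/
theorem exists_unbounded_of_regressive {ι : Type*} [Countable ι]
    {Q : OmegaOne → OmegaOne → ι → Prop} (hQ : ∀ a ∈ limitSet, ∃ b < a, ∃ c, Q a b c) :
    ∃ b c, ∀ d, ∃ a ∈ limitSet, d < a ∧ Q a b c := by
  by_contra! H
  choose δ hδ using H
  have hg : ∀ d, ∃ e, ∀ b ≤ d, ∀ c, δ b c < e := fun d => by
    have := (countable_Iic d).to_subtype
    obtain ⟨e, he⟩ := exists_gt_of_countable fun p : Iic d × ι => δ p.1 p.2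
    exact ⟨e, fun b hb c => he (⟨b, hb⟩, c)⟩
  choose g hg using hg
  -- `g d` bounds every `δ b c` with `b ≤ d`, so at a limit closed under `g` the value chosen at `a`
  -- is already bounded below `a`.
  obtain ⟨a, ha, -, h⟩ := exists_limit_gt_of_seq g ⊥
  obtain ⟨b, hb, c, hQ⟩ := hQ a ha
  obtain ⟨d, hbd, -, hda⟩ := h b hb
  exact hδ b c a ha ((hg d b hbd c).trans hda) hQ

theorem exists_limit_gt (b : OmegaOne) : ∃ a ∈ limitSet, b < a := by
  obtain ⟨a, ha, hb, -⟩ := exists_limit_gt_of_seq id b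
  exact ⟨a, ha, hb⟩

end OmegaOne

namespace KuleszaSpace

open OmegaOne

theorem unique_limit (z : KuleszaSpace) {i j : ℕ} (hi : z.1 i ∈ limitSet)
    (hj : z.1 j ∈ limitSet) : i = j :=
  z.2.2.1 hi hj

theorem apply_succ (z : KuleszaSpace) {k : ℕ} (hk : z.1 k ∈ limitSet) :
    z.1 (k + 1) = addNat (z.1 k) k :=
  Subtype.ext (z.2.2.2 k hk).1

theorem apply_of_lt (z : KuleszaSpace) {k j : ℕ} (hk : z.1 k ∈ limitSet) (hj : k + 2 ≤ j) :
    ∃ b ∈ limitSet, z.1 j = addNat b k := by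
  obtain ⟨i, rfl⟩ := Nat.exists_eq_add_of_le hj
  have := (z.2.2.2 k hk).2 (2 + i) (by omega)
  rwa [mem_limitSetAdd, ← add_assoc] at this

/-- The first `n` terms of `w` agree with those of `z`, except that a limit term of `z` may be
replaced by a smaller term exceeding `c`. -/
def Near (c : OmegaOne) (n : ℕ) (z w : ℕ → OmegaOne) : Prop :=
  ∀ i < n, w i = z i ∨ z i ∈ limitSet ∧ c < w i ∧ w i ≤ z i

theorem Near.of_notMem {c : OmegaOne} {n : ℕ} {z w : ℕ → OmegaOne} (h : Near c n z w) {i : ℕ}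
    (hi : i < n) (hz : z i ∉ limitSet) : w i = z i :=
  (h i hi).resolve_right fun h => hz h.1

theorem exists_near_subset {z : KuleszaSpace} {V : Set KuleszaSpace} (hV : V ∈ 𝓝 z) :
    ∃ (n : ℕ) (c : OmegaOne), (∀ i, z.1 i ∈ limitSet → c < z.1 i) ∧
      ∀ w : KuleszaSpace, Near c n z.1 w.1 → w ∈ V := by
  rw [nhds_subtype_eq_comap, mem_comap] at hV
  obtain ⟨T, hT, hTV⟩ := hV
  rw [nhds_pi, Filter.mem_pi] at hT
  obtain ⟨I, hI, t, ht, htT⟩ := hT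
  obtain ⟨N, hN⟩ := hI.bddAbove
  obtain ⟨c, hc, hct⟩ : ∃ c : OmegaOne, (∀ i, z.1 i ∈ limitSet → c < z.1 i) ∧
      ∀ i, z.1 i ∈ limitSet → Ioc c (z.1 i) ⊆ t i := by
    by_cases h : ∃ k, z.1 k ∈ limitSet
    · obtain ⟨k, hk⟩ := h
      obtain ⟨c, hc, hct⟩ := (hasBasis_nhds hk).mem_iff.1 (ht k)
      refine ⟨c, fun i hi => ?_, fun i hi => ?_⟩
      · rwa [unique_limit z hi hk]
      · rwa [unique_limit z hi hk]
    · exact ⟨⊥, fun i hi => (h ⟨i, hi⟩).elim, fun i hi => (h ⟨i, hi⟩).elim⟩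
  refine ⟨N + 1, c, hc, fun w hw => hTV (htT fun i hi => ?_)⟩
  rcases hw i (Nat.lt_succ_of_le (hN hi)) with h | ⟨h1, h2⟩
  · rw [h]
    exact mem_of_mem_nhds (ht i)
  · exact hct i h1 h2

theorem setOf_near_mem_nhds (z : KuleszaSpace) {c : OmegaOne} {n : ℕ}
    (hc : ∀ i < n, z.1 i ∈ limitSet → c < z.1 i) : {w : KuleszaSpace | Near c n z.1 w.1} ∈ 𝓝 z := by
  refine (eventually_all_finite (finite_lt_nat n)).2 fun i hi => ?_
  have hcont : ContinuousAt (fun w : KuleszaSpace => w.1 i) z :=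
    ((continuous_apply i).comp continuous_subtype_val).continuousAt
  by_cases h : z.1 i ∈ limitSet
  · filter_upwards [hcont (Ioc_mem_nhds (hc i hi h))] with w hw using .inr ⟨h, hw⟩
  · have : {z.1 i} ∈ 𝓝 (z.1 i) := by rw [nhds_eq_pure h]; rfl
    filter_upwards [hcont this] with w hw using .inl hw

/-! ### Metrizability through a countably generated uniformity. -/

section Metrizable

variable (γ : OmegaOne → ℕ → OmegaOne)

/-- The relation between the points `z` and `w` for `w` to lie in the `n`-th basic neighbourhood of
`z`, for a choice `γ` of ladders. -/
def BasicNear (n : ℕ) (z w : ℕ → OmegaOne) : Prop :=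
  (∀ k < n, z k ∈ limitSet → Near (γ (z k) n) (n + 2) z w) ∧
    ∀ i < n, z i ∉ limitSet → w i = z i

variable {γ}

theorem BasicNear.refl (n : ℕ) (z : ℕ → OmegaOne) : BasicNear γ n z z :=
  ⟨fun _ _ _ _ _ => .inl rfl, fun _ _ _ => rfl⟩

theorem BasicNear.anti (hγ : ∀ a ∈ limitSet, Monotone (γ a)) {m n : ℕ} (hmn : m ≤ n)
    {z w : ℕ → OmegaOne} (h : BasicNear γ n z w) : BasicNear γ m z w := by
  refine ⟨fun k hk hz i hi => ?_, fun i hi => h.2 i (hi.trans_le hmn)⟩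
  rcases h.1 k (hk.trans_le hmn) hz i (by omega) with h | ⟨h1, h2, h3⟩
  · exact .inl h
  · exact .inr ⟨h1, (hγ _ hz hmn).trans_lt h2, h3⟩

theorem BasicNear.congr {n : ℕ} {z v w : ℕ → OmegaOne} (h : BasicNear γ n z v)
    (hvw : ∀ i < n + 2, w i = v i) : BasicNear γ n z w := by
  refine ⟨fun k hk hz i hi => ?_, fun i hi hz => ?_⟩
  · rw [hvw i hi]
    exact h.1 k hk hz i hi
  · rw [hvw i (by omega)]
    exact h.2 i hi hz

/-- If `k < k'`, the term `y (k' + 1)` would lie in `L + k` because of `z` and in `L + k'` because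
of `z'`. Control of `m + 2` terms keeps place `k' + 1` in range. -/
theorem BasicNear.limit_not_lt {m : ℕ} {z z' y : KuleszaSpace} (h : BasicNear γ m z.1 y.1)
    (h' : BasicNear γ m z'.1 y.1) {k k' : ℕ} (hk : k < m) (hk' : k' < m) (hz : z.1 k ∈ limitSet)
    (hz' : z'.1 k' ∈ limitSet) : ¬ k < k' := by
  intro hlt
  obtain ⟨b, hb, hbk⟩ := apply_of_lt z hz (j := k' + 1) (by omega)
  have h1 : y.1 (k' + 1) = z.1 (k' + 1) := (h.1 k hk hz).of_notMem (by omega) fun hl => by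
    have := unique_limit z hl hz
    omega
  have h2 : y.1 (k' + 1) = z'.1 (k' + 1) := (h'.1 k' hk' hz').of_notMem (by omega) fun hl => by
    have := unique_limit z' hl hz'
    omega
  rw [h1, hbk, apply_succ z' hz'] at h2
  have := (addNat_injective hb hz' h2).2
  omega

theorem BasicNear.agree {m : ℕ} {z z' y : KuleszaSpace} (h : BasicNear γ m z.1 y.1)
    (h' : BasicNear γ m z'.1 y.1) {k k' : ℕ} (hk : k < m) (hk' : k' < m) (hz : z.1 k ∈ limitSet)
    (hz' : z'.1 k' ∈ limitSet) : ∀ i < m + 2, z'.1 i = z.1 i := by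
  obtain rfl : k = k' := le_antisymm (not_lt.1 (h'.limit_not_lt h hk' hk hz' hz))
    (not_lt.1 (h.limit_not_lt h' hk hk' hz hz'))
  have key : ∀ i < m + 2, i ≠ k → z'.1 i = z.1 i := fun i hi hik => by
    rw [← (h.1 k hk hz).of_notMem hi fun hl => hik (unique_limit z hl hz),
      ← (h'.1 k hk hz').of_notMem hi fun hl => hik (unique_limit z' hl hz')]
  intro i hi
  by_cases hik : i = k
  · subst hik
    have := key (i + 1) (by omega) (by omega)
    rw [apply_succ z hz, apply_succ z' hz'] at this
    exact (addNat_injective hz' hz this).1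
  · exact key i hi hik

/-- If `z'` has no early limit, `v` and `y` agree far enough to exchange them; if both centres have
one, `BasicNear.agree` lets `z` replace `z'`. The excluded case, a limit in `z'` only, is handled in
`entourage_comp` by exchanging the two centres. -/
theorem BasicNear.trans (hγ : ∀ a ∈ limitSet, Monotone (γ a)) {n : ℕ} {z z' y v : KuleszaSpace}
    (h : BasicNear γ (n + 2) z.1 y.1) (h' : BasicNear γ (n + 2) z'.1 y.1)
    (hv : BasicNear γ (n + 2) z'.1 v.1)
    (hz : (∃ k < n + 2, z.1 k ∈ limitSet) ∨ ∀ k < n + 2, z'.1 k ∉ limitSet) :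
    BasicNear γ n z.1 v.1 := by
  by_cases hz' : ∀ k < n + 2, z'.1 k ∉ limitSet
  · exact (h.anti hγ (by omega)).congr fun i hi => by
      rw [h'.2 i hi (hz' i hi), hv.2 i hi (hz' i hi)]
  obtain ⟨k, hk, hzk⟩ := hz.resolve_right hz'
  push Not at hz'
  obtain ⟨k', hk', hzk'⟩ := hz'
  have hag := h.agree h' hk hk' hzk hzk'
  refine BasicNear.anti hγ (n := n + 2) (by omega) ⟨fun j hj hzj i hi => ?_, fun i hi hzi => ?_⟩
  · rw [← hag j (by omega)] at hzj ⊢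
    rw [← hag i hi]
    exact hv.1 j hj hzj i hi
  · rw [← hag i (by omega)] at hzi ⊢
    exact hv.2 i hi hzi

variable (γ) in
/-- The entourages of a uniformity on Kulesza's space. -/
def entourage (n : ℕ) : Set (KuleszaSpace × KuleszaSpace) :=
  {p | ∃ z : KuleszaSpace, BasicNear γ n z.1 p.1.1 ∧ BasicNear γ n z.1 p.2.1}

theorem entourage_comp (hγ : ∀ a ∈ limitSet, Monotone (γ a)) {n : ℕ} {x y w : KuleszaSpace}
    (hxy : (x, y) ∈ entourage γ (n + 2)) (hyw : (y, w) ∈ entourage γ (n + 2)) :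
    (x, w) ∈ entourage γ n := by
  obtain ⟨z, hzx, hzy⟩ := hxy
  obtain ⟨z', hzy', hzw⟩ := hyw
  by_cases hz : (∃ k < n + 2, z.1 k ∈ limitSet) ∨ ∀ k < n + 2, z'.1 k ∉ limitSet
  · exact ⟨z, hzx.anti hγ (by omega), hzy.trans hγ hzy' hzw hz⟩
  · push Not at hz
    exact ⟨z', hzy'.trans hγ hzy hzx (.inl hz.2), hzw.anti hγ (by omega)⟩

theorem basicNear_mem_nhds (hlt : ∀ a ∈ limitSet, ∀ n, γ a n < a) (n : ℕ) (z : KuleszaSpace) :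
    {w : KuleszaSpace | BasicNear γ n z.1 w.1} ∈ 𝓝 z := by
  by_cases h : ∃ k < n, z.1 k ∈ limitSet
  · obtain ⟨k, hk, hz⟩ := h
    have := setOf_near_mem_nhds z (c := γ (z.1 k) n) (n := n + 2) fun i _ hi => by
      rw [unique_limit z hi hz]
      exact hlt _ hz n
    filter_upwards [this] with w hw
    refine ⟨fun j hj hzj => ?_, fun i hi hzi => hw.of_notMem (by omega) hzi⟩
    rwa [unique_limit z hzj hz]
  · push Not at h
    have := setOf_near_mem_nhds z (c := ⊥) (n := n) fun i hi hl => (h i hi hl).elim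
    filter_upwards [this] with w hw
    exact ⟨fun k hk hz => (h k hk hz).elim, fun i hi hz => hw.of_notMem hi hz⟩

theorem exists_entourage_subset (hγ : ∀ a ∈ limitSet, Monotone (γ a))
    (hcof : ∀ a ∈ limitSet, ∀ b < a, ∃ n, b ≤ γ a n) {z : KuleszaSpace}
    {V : Set KuleszaSpace} (hV : V ∈ 𝓝 z) :
    ∃ n, ∀ w, (z, w) ∈ entourage γ n → w ∈ V := by
  obtain ⟨p, c, hc, hcV⟩ := exists_near_subset hV
  by_cases h : ∃ k, z.1 k ∈ limitSet
  · obtain ⟨k, hk⟩ := h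
    obtain ⟨n, hn⟩ := hcof _ hk c (hc k hk)
    let N := max n (max p (k + 1))
    have hN : n ≤ N ∧ p ≤ N ∧ k < N := by simp only [N]; omega
    refine ⟨N + 2, fun w ⟨z', hz, hw⟩ => hcV w ?_⟩
    have := (BasicNear.refl (N + 2) z.1).trans hγ hz hw (.inl ⟨k, by omega, hk⟩)
    intro i hi
    rcases this.1 k hN.2.2 hk i (by omega) with h | ⟨h1, h2, h3⟩
    · exact .inl h
    · exact .inr ⟨h1, (hn.trans (hγ _ hk hN.1)).trans_lt h2, h3⟩
  · push Not at h
    -- The term `z (k + 1)` admits at most one limit `a` with `z (k + 1) = a + k`, so one ladder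
    -- index per place suffices to keep `z k` out of the neighbourhoods of points with `a` at place
    -- `k`; the value 0 is used if there is no such `a` above `z k`.
    have hm : ∀ k, ∃ m, ∀ a ∈ limitSet, z.1 (k + 1) = addNat a k → z.1 k < a →
        z.1 k ≤ γ a m := fun k => by
      by_cases hk : ∃ a ∈ limitSet, z.1 (k + 1) = addNat a k ∧ z.1 k < a
      · obtain ⟨a, ha, hak, hlt⟩ := hk
        obtain ⟨m, hm⟩ := hcof a ha _ hlt
        refine ⟨m, fun b hb hbk _ => ?_⟩
        rwa [(addNat_injective hb ha (hbk.symm.trans hak)).1]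
      · exact ⟨0, fun a ha hak hlt => (hk ⟨a, ha, hak, hlt⟩).elim⟩
    choose m hm using hm
    let N := max p ((Finset.range p).sup m)
    have hpN : p ≤ N := le_max_left _ _
    refine ⟨N, fun w ⟨z', hz, hw⟩ => hcV w fun i hi => .inl ?_⟩
    have hiN := hi.trans_le hpN
    by_cases hz' : z'.1 i ∈ limitSet
    · exfalso
      have h1 : z.1 (i + 1) = z'.1 (i + 1) := (hz.1 i hiN hz').of_notMem (by omega) fun hl => by
        have := unique_limit z' hl hz'
        omega
      rw [apply_succ z' hz'] at h1
      rcases hz.1 i hiN hz' i (by omega) with h2 | ⟨-, h2, h3⟩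
      · exact h i (h2 ▸ hz')
      · have h4 := hm i _ hz' h1 (h3.lt_of_ne fun h5 => h i (h5 ▸ hz'))
        have h5 : m i ≤ N :=
          (Finset.le_sup (f := m) (Finset.mem_range.2 hi)).trans (le_max_right _ _)
        exact not_lt.2 (h4.trans (hγ _ hz' h5)) h2
    · rw [hw.2 i hiN hz', hz.2 i hiN hz']

theorem metrizableSpace : MetrizableSpace KuleszaSpace := by
  have hlad : ∀ a : OmegaOne, ∃ γ : ℕ → OmegaOne, a ∈ limitSet →
      Monotone γ ∧ (∀ n, γ n < a) ∧ ∀ b < a, ∃ n, b ≤ γ n := fun a => by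
    by_cases ha : a ∈ limitSet
    · obtain ⟨γ, hγ⟩ := exists_ladder a ha
      exact ⟨γ, fun _ => hγ⟩
    · exact ⟨fun _ => ⊥, fun h => (ha h).elim⟩
  choose γ hγ using hlad
  have hmono : ∀ a ∈ limitSet, Monotone (γ a) := fun a ha => (hγ a ha).1
  have hanti : Antitone (entourage γ) := fun m n hmn p ⟨z, h1, h2⟩ =>
    ⟨z, h1.anti hmono hmn, h2.anti hmono hmn⟩
  have hB : (⨅ n, 𝓟 (entourage γ n)).HasBasis (fun _ => True) (entourage γ) :=
    hasBasis_iInf_principal hanti.directed_ge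
  let u : UniformSpace KuleszaSpace :=
    { toTopologicalSpace := kuleszaTopology
      uniformity := ⨅ n, 𝓟 (entourage γ n)
      symm := by
        refine (hB.tendsto_iff hB).2 fun n _ => ⟨n, trivial, fun p ⟨z, h1, h2⟩ => ⟨z, h2, h1⟩⟩
      comp := by
        refine (hB.lift' (monotone_id.relComp monotone_id)).le_basis_iff hB |>.2
          fun n _ => ⟨n + 2, trivial, ?_⟩
        rintro ⟨x, w⟩ ⟨y, hxy, hyw⟩
        exact entourage_comp hmono hxy hyw
      nhds_eq_comap_uniformity := fun z => by
        refine le_antisymm ?_ fun V hV => ?_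
        · refine (hB.comap _).ge_iff.2 fun n _ => ?_
          filter_upwards [basicNear_mem_nhds (fun a ha => (hγ a ha).2.1) n z] with w hw
          exact ⟨z, .refl _ _, hw⟩
        · obtain ⟨n, hn⟩ := exists_entourage_subset hmono (fun a ha => (hγ a ha).2.2) hV
          exact (hB.comap _).mem_iff.2 ⟨n, trivial, hn⟩ }
  have : IsCountablyGenerated (uniformity KuleszaSpace) := hB.isCountablyGenerated
  exact UniformSpace.metrizableSpace

end Metrizable

/-! ### Dimension zero. -/

theorem smallInductiveDimension_eq_zero : smallInductiveDimension KuleszaSpace = 0 := by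
  refine smallInductiveDimension_eq 0 ?_ ?_
  · refine hasSmallInductiveDimensionLT_one_iff.2 (isTopologicalBasis_of_isOpen_of_nhds
      (fun U hU => IsClopen.isOpen hU) fun z V hz hV => ?_)
    obtain ⟨n, c, hc, hcV⟩ := exists_near_subset (hV.mem_nhds hz)
    refine ⟨{w | Near c n z.1 w.1}, ?_, fun i _ => .inl rfl, hcV⟩
    have : {w : KuleszaSpace | Near c n z.1 w.1} =
        ⋂ i ∈ Iio n, {w | w.1 i = z.1 i ∨ z.1 i ∈ limitSet ∧ c < w.1 i ∧ w.1 i ≤ z.1 i} := by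
      ext w
      simp [Near]
    rw [mem_ofPred_eq, this]
    refine (finite_Iio n).isClopen_biInter fun i _ => ?_
    have hcont : Continuous fun w : KuleszaSpace => w.1 i :=
      (continuous_apply i).comp continuous_subtype_val
    by_cases hi : z.1 i ∈ limitSet
    · convert (isClopen_Ioc c (z.1 i)).preimage hcont using 1
      ext w
      simp only [hi, true_and, mem_ofPred_eq, mem_preimage, mem_Ioc, or_iff_right_iff_imp]
      rintro h
      rw [h]
      exact ⟨hc i hi, le_rfl⟩
    · convert (isClopen_singleton hi).preimage hcont using 1
      ext w
      simp [hi]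
  · rw [hasSmallInductiveDimensionLT_zero_iff, not_isEmpty_iff]
    exact ⟨⟨fun _ => ⊥, bot_notMem_limitSet, fun i hi => (bot_notMem_limitSet hi).elim,
      fun i hi => (bot_notMem_limitSet hi).elim⟩⟩

/-- Extend the first `n` terms of a sequence step by step to an infinite sequence. -/
theorem exists_branch {A : Type*} {P : ℕ → (ℕ → A) → Prop}
    (hcongr : ∀ m p q, (∀ i < m, q i = p i) → P m p → P m q) {n : ℕ} {p : ℕ → A} (h : P n p)
    (hstep : ∀ m ≥ n, ∀ q, P m q → ∃ u, P (m + 1) (Function.update q m u)) :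
    ∃ q, (∀ i < n, q i = p i) ∧ ∀ m ≥ n, P m q := by
  have hstep' : ∀ x : {x : ℕ × (ℕ → A) // n ≤ x.1 ∧ P x.1 x.2},
      ∃ u, P (x.1.1 + 1) (Function.update x.1.2 x.1.1 u) :=
    fun x => hstep _ x.2.1 _ x.2.2
  choose u hu using hstep'
  let S : {x : ℕ × (ℕ → A) // n ≤ x.1 ∧ P x.1 x.2} → {x : ℕ × (ℕ → A) // n ≤ x.1 ∧ P x.1 x.2} :=
    fun x => ⟨(x.1.1 + 1, Function.update x.1.2 x.1.1 (u x)), by have := x.2.1; dsimp only; omega,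
      hu x⟩
  let s : ℕ → {x : ℕ × (ℕ → A) // n ≤ x.1 ∧ P x.1 x.2} := fun j => S^[j] ⟨(n, p), le_rfl, h⟩
  have hs : ∀ j, s (j + 1) = S (s j) := fun j => Function.iterate_succ_apply' S j _
  have h1 : ∀ j, (s j).1.1 = n + j := fun j => by
    induction j with
    | zero => rfl
    | succ j ih => rw [hs]; change (s j).1.1 + 1 = _; omega
  have h2 : ∀ j l i, i < n + j → (s (j + l)).1.2 i = (s j).1.2 i := fun j l i hi => by
    induction l with
    | zero => rfl
    | succ l ih =>
      rw [← add_assoc, hs, ← ih]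
      exact Function.update_of_ne (by have := h1 (j + l); omega) _ _
  let q : ℕ → A := fun i => (s (i + 1)).1.2 i
  have hq : ∀ j, ∀ i < n + j, q i = (s j).1.2 i := fun j i hi => by
    rcases le_total j (i + 1) with hj | hj
    · obtain ⟨l, hl⟩ := Nat.exists_eq_add_of_le hj
      change (s (i + 1)).1.2 i = _
      rw [hl, h2 j l i hi]
    · obtain ⟨l, rfl⟩ := Nat.exists_eq_add_of_le hj
      exact (h2 (i + 1) l i (by omega)).symm
  refine ⟨q, hq 0, fun m hm => ?_⟩
  obtain ⟨j, rfl⟩ := Nat.exists_eq_add_of_le hm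
  have := (s j).2.2
  rw [h1] at this
  exact hcongr _ _ _ (hq j) this

/-- A sequence without limit terms, as a point of Kulesza's space. -/
def ofNonlimit (x : ℕ → OmegaOne) (hx : ∀ i, x i ∉ limitSet) : KuleszaSpace :=
  ⟨x, hx 0, fun i hi => (hx i hi).elim, fun i hi => (hx i hi).elim⟩

/-- A sequence with exactly one limit term, as a point of Kulesza's space. -/
def ofLimit (x : ℕ → OmegaOne) {k : ℕ} (hk : 1 ≤ k) (hxk : x k ∈ limitSet)
    (hx : ∀ i < k, x i ∉ limitSet) (hx1 : x (k + 1) = addNat (x k) k)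
    (hx2 : ∀ i ≥ k + 2, ∃ b ∈ limitSet, x i = addNat b k) : KuleszaSpace :=
  have key : ∀ i, x i ∈ limitSet → i = k := fun i hi => by
    obtain ⟨j, rfl⟩ := Nat.exists_eq_add_of_le' hk
    by_contra hne
    rcases lt_or_gt_of_ne hne with h | h
    · exact hx i h hi
    · rcases Nat.lt_or_ge i (j + 1 + 2) with h' | h'
      · obtain rfl : i = j + 1 + 1 := by omega
        rw [hx1] at hi
        exact addNat_succ_notMem_limitSet _ _ hi
      · obtain ⟨b, -, hb⟩ := hx2 i h'
        rw [hb] at hi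
        exact addNat_succ_notMem_limitSet _ _ hi
  ⟨x, hx 0 hk, fun i hi j hj => (key i hi).trans (key j hj).symm, fun i hi => by
    obtain rfl := key i hi
    exact ⟨congrArg Subtype.val hx1, fun j hj => mem_limitSetAdd.2 (hx2 _ (by omega))⟩⟩

/-- The first `n` terms of `p` are pairs of ordinals that are not limits. -/
def IsNode (n : ℕ) (p : ℕ → OmegaOne × OmegaOne) : Prop :=
  ∀ i < n, (p i).1 ∉ limitSet ∧ (p i).2 ∉ limitSet

/-- The pair of points `z` extends the first `n` terms of `p`. -/
def Extends (n : ℕ) (p : ℕ → OmegaOne × OmegaOne) (z : KuleszaSpace × KuleszaSpace) : Prop :=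
  ∀ i < n, (z.1.1 i, z.2.1 i) = p i

/-- The set `V` contains the pairs of branches through a tree with uncountable branching, above the
first `n` terms of `p`. -/
inductive Large (V : Set (KuleszaSpace × KuleszaSpace)) :
    ℕ → (ℕ → OmegaOne × OmegaOne) → Prop
  | base {n : ℕ} {p : ℕ → OmegaOne × OmegaOne} (h : ∀ z, Extends n p z → z ∈ V) : Large V n p
  | step {n : ℕ} {p : ℕ → OmegaOne × OmegaOne} (u : OmegaOne → OmegaOne) (hu : ∀ b, b < u b)
      (hul : ∀ b, u b ∉ limitSet) (h : ∀ b, Large V (n + 1) (Function.update p n (u b, u b))) :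
      Large V n p

/-! ### Large sets of pairs. -/

variable {V : Set (KuleszaSpace × KuleszaSpace)} {n : ℕ} {p q : ℕ → OmegaOne × OmegaOne}

theorem IsNode.congr (h : IsNode n p) (hpq : ∀ i < n, q i = p i) : IsNode n q := fun i hi => by
  rw [hpq i hi]
  exact h i hi

theorem IsNode.update (h : IsNode n p) {u v : OmegaOne} (hu : u ∉ limitSet) (hv : v ∉ limitSet) :
    IsNode (n + 1) (Function.update p n (u, v)) := fun i hi => by
  rcases Nat.lt_succ_iff_lt_or_eq.1 hi with h' | rfl
  · rw [Function.update_of_ne h'.ne]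
    exact h i h'
  · rw [Function.update_self]
    exact ⟨hu, hv⟩

theorem update_agree {A : Type*} {p q : ℕ → A} (hpq : ∀ i < n, q i = p i) (u : A) :
    ∀ i < n + 1, Function.update q n u i = Function.update p n u i := fun i hi => by
  rcases Nat.lt_succ_iff_lt_or_eq.1 hi with h' | rfl
  · rw [Function.update_of_ne h'.ne, Function.update_of_ne h'.ne, hpq i h']
  · rw [Function.update_self, Function.update_self]

theorem Large.of_forall_exists
    (h : ∀ b, ∃ u > b, u ∉ limitSet ∧ Large V (n + 1) (Function.update p n (u, u))) :
    Large V n p := by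
  choose u hu hul h using h
  exact .step u hu hul h

theorem Large.congr (h : Large V n p) (hpq : ∀ i < n, q i = p i) : Large V n q := by
  induction h generalizing q with
  | base h => exact .base fun z hz => h z fun i hi => (hz i hi).trans (hpq i hi)
  | step u hu hul _ ih => exact .step u hu hul fun b => ih b (update_agree hpq _)

theorem Large.exists_child (h : Large V n p) (b : OmegaOne) :
    ∃ u > b, u ∉ limitSet ∧ Large V (n + 1) (Function.update p n (u, u)) := by
  cases h with
  | base h =>
    refine ⟨addNat b 1, lt_addNat_one b, addNat_succ_notMem_limitSet b 0, .base fun z hz => ?_⟩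
    refine h z fun i hi => ?_
    rw [hz i (by omega), Function.update_of_ne hi.ne]
  | step u hu hul h => exact ⟨u b, hu b, hul b, h b⟩

/-- Follow one path of the tree to a leaf and pad with the non-limit `⊥`. -/
theorem Large.exists_mem (h : Large V n p) (hp : IsNode n p) : ∃ z ∈ V, Extends n p z := by
  induction h with
  | @base n p h =>
    refine ⟨_, h (ofNonlimit (fun i => if i < n then (p i).1 else ⊥) fun i => ?_,
      ofNonlimit (fun i => if i < n then (p i).2 else ⊥) fun i => ?_) ?_, ?_⟩
    · split_ifs with hi
      exacts [(hp i hi).1, bot_notMem_limitSet]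
    · split_ifs with hi
      exacts [(hp i hi).2, bot_notMem_limitSet]
    all_goals
      intro i hi
      simp [ofNonlimit, hi]
  | @step n p u _ hul _ ih =>
    obtain ⟨z, hz, hzp⟩ := ih ⊥ (hp.update (hul ⊥) (hul ⊥))
    refine ⟨z, hz, fun i hi => ?_⟩
    rw [hzp i (by omega), Function.update_of_ne hi.ne]

/-- If `V` is open and contains a pair of points without limit terms, then the complement of `V`
is not large along that pair. -/
theorem exists_not_large_compl (hV : IsOpen V) {q : ℕ → OmegaOne × OmegaOne}
    (hq1 : ∀ i, (q i).1 ∉ limitSet) (hq2 : ∀ i, (q i).2 ∉ limitSet)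
    (hqV : (ofNonlimit _ hq1, ofNonlimit _ hq2) ∈ V) : ∃ N, ∀ m ≥ N, ¬ Large Vᶜ m q := by
  obtain ⟨A, hA, B, hB, hAB⟩ := mem_nhds_prod_iff.1 (hV.mem_nhds hqV)
  obtain ⟨a, c, -, haA⟩ := exists_near_subset hA
  obtain ⟨b, d, -, hbB⟩ := exists_near_subset hB
  refine ⟨max a b, fun m hm hl => ?_⟩
  obtain ⟨z, hz, hzq⟩ := hl.exists_mem fun i _ => ⟨hq1 i, hq2 i⟩
  refine hz (hAB ⟨haA _ fun i hi => .inl ?_, hbB _ fun i hi => .inl ?_⟩)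
  · exact congrArg Prod.fst (hzq i (by omega))
  · exact congrArg Prod.snd (hzq i (by omega))

/-- Otherwise each of the countably many pairs `(b, c)` has a bad node. One tail `t` keeps all of
them bad, yet it completes `p`, `a`, `a + n` to a pair of points whose neighbourhood lies in `V` or
`Vᶜ` and captures one of the bad nodes. -/
theorem exists_large_of_limit (hV : IsClopen V) (hn : 1 ≤ n) (hp : IsNode n p) {a : OmegaOne}
    (ha : a ∈ limitSet) :
    ∃ b < a, ∃ c : Bool, ∀ v v', b < v → v < a → v ∉ limitSet → b < v' → v' < a → v' ∉ limitSet →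
      Large (bif c then V else Vᶜ) (n + 2)
        (Function.update (Function.update p n (v, v')) (n + 1) (addNat a n, addNat a n)) := by
  by_contra! H
  have H' : ∀ x : Iio a × Bool, ∃ v v', x.1.1 < v ∧ v < a ∧ v ∉ limitSet ∧ x.1.1 < v' ∧ v' < a ∧
      v' ∉ limitSet ∧ ¬ Large (bif x.2 then V else Vᶜ) (n + 2)
        (Function.update (Function.update p n (v, v')) (n + 1) (addNat a n, addNat a n)) :=
    fun x => H x.1 x.1.2 x.2
  choose v v' h1 h2 h3 h4 h5 h6 h7 using H'
  have hcount := (countable_Iio a).to_subtype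
  -- the common tail of the bad nodes
  let ins : Iio a × Bool → (ℕ → OmegaOne) → ℕ → OmegaOne × OmegaOne := fun x t i =>
    if i < n + 2 then
      Function.update (Function.update p n (v x, v' x)) (n + 1) (addNat a n, addNat a n) i
    else (t i, t i)
  obtain ⟨t, -, ht⟩ := exists_branch
    (P := fun m t => (∀ x, ¬ Large (bif x.2 then V else Vᶜ) m (ins x t)) ∧
      ∀ i, n + 2 ≤ i → i < m → ∃ b ∈ limitSet, t i = addNat b n)
    (n := n + 2) (p := fun _ => ⊥) (by
      rintro m t s hts ⟨hl, hb⟩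
      refine ⟨fun x hx => hl x (hx.congr fun i hi => ?_), fun i hi him => ?_⟩
      · simp only [ins, hts i hi]
      · rw [hts i him]
        exact hb i hi him)
    ⟨fun x hx => h7 x (hx.congr fun i hi => by simp only [ins, hi, if_true]),
      fun i hi him => by omega⟩ (by
      rintro m hm t ⟨hl, hb⟩
      -- At a bad node the good children `(u, u)` are bounded; countably many bounds have a common
      -- one, and `b + n` is taken beyond it.
      have hbd : ∀ x, ∃ d, ∀ u > d, u ∉ limitSet →
          ¬ Large (bif x.2 then V else Vᶜ) (m + 1) (Function.update (ins x t) m (u, u)) := by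
        intro x
        by_contra! hx
        exact hl x (.of_forall_exists hx)
      choose d hd using hbd
      obtain ⟨e, he⟩ := exists_gt_of_countable d
      obtain ⟨b, hbl, hbe⟩ := exists_limit_gt e
      refine ⟨addNat b n, fun x hx => ?_, fun i hi him => ?_⟩
      · refine hd x (addNat b n) ((he x).trans (hbe.trans_le (le_addNat b n))) ?_ (hx.congr ?_)
        · obtain ⟨j, rfl⟩ := Nat.exists_eq_add_of_le' hn
          exact addNat_succ_notMem_limitSet b j
        · intro i hi
          rcases Nat.lt_succ_iff_lt_or_eq.1 hi with h' | rfl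
          · rw [Function.update_of_ne h'.ne]
            simp only [ins, Function.update_of_ne h'.ne]
          · simp [ins, not_lt.2 hm]
      · rcases Nat.lt_succ_iff_lt_or_eq.1 him with h' | rfl
        · rw [Function.update_of_ne h'.ne]
          exact hb i hi h'
        · exact ⟨b, hbl, Function.update_self ..⟩)
  -- the pair of points with the limit `a` at place `n`
  let pt : (ℕ → OmegaOne) → ℕ → OmegaOne := fun y i =>
    if i < n then y i else if i = n then a else if i = n + 1 then addNat a n else t i
  have hpt : ∀ y : ℕ → OmegaOne, (∀ i < n, y i ∉ limitSet) →
      ∃ z : KuleszaSpace, z.1 = pt y := fun y hy => by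
    refine ⟨ofLimit (pt y) hn ?_ (fun i hi => ?_) ?_ (fun i hi => ?_), rfl⟩
    · simpa [pt] using ha
    · simpa [pt, hi] using hy i hi
    · simp [pt]
    · obtain ⟨b, hb, hbt⟩ := (ht (i + 1) (by omega)).2 i hi (by omega)
      refine ⟨b, hb, ?_⟩
      rw [← hbt]
      simp only [pt]
      rw [if_neg (by omega), if_neg (by omega), if_neg (by omega)]
  obtain ⟨z, hz⟩ := hpt (fun i => (p i).1) fun i hi => (hp i hi).1
  obtain ⟨z', hz'⟩ := hpt (fun i => (p i).2) fun i hi => (hp i hi).2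
  obtain ⟨c, hc⟩ : ∃ c : Bool, (bif c then V else Vᶜ) ∈ 𝓝 (z, z') := by
    by_cases hzV : (z, z') ∈ V
    · exact ⟨true, hV.isOpen.mem_nhds hzV⟩
    · exact ⟨false, hV.compl.isOpen.mem_nhds hzV⟩
  obtain ⟨A, hA, B, hB, hAB⟩ := mem_nhds_prod_iff.1 hc
  obtain ⟨m, e, he, heA⟩ := exists_near_subset hA
  obtain ⟨m', e', he', heB⟩ := exists_near_subset hB
  have hzn : z.1 n = a := by rw [hz]; simp [pt]
  have hzn' : z'.1 n = a := by rw [hz']; simp [pt]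
  have hea : max e e' < a :=
    max_lt (hzn ▸ he n (hzn.symm ▸ ha)) (hzn' ▸ he' n (hzn'.symm ▸ ha))
  let x : Iio a × Bool := (⟨max e e', hea⟩, c)
  have hpn : ∀ i < n, ins x t i = p i := fun i hi => by
    have h1 : i ≠ n := by omega
    have h2 : i ≠ n + 1 := by omega
    simp [ins, h1, h2, show i < n + 2 by omega]
  have hpn0 : ins x t n = (v x, v' x) := by simp [ins]
  have hpn1 : ins x t (n + 1) = (addNat a n, addNat a n) := by simp [ins]
  have hpn2 : ∀ i, n + 2 ≤ i → ins x t i = (t i, t i) := fun i hi => by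
    simp [ins, not_lt.2 hi]
  have hpti : ∀ y i, n + 2 ≤ i → pt y i = t i := fun y i hi => by
    simp only [pt]
    rw [if_neg (by omega), if_neg (by omega), if_neg (by omega)]
  have hcases : ∀ i, i < n ∨ i = n ∨ i = n + 1 ∨ n + 2 ≤ i := fun i => by omega
  -- Far enough along the tail, every extension of the bad node `x` lies in the neighbourhood, so
  -- the node is a leaf of a tree for the side `c`.
  refine (ht (max (max m m') (n + 2)) (le_max_right _ _)).1 x (.base fun w hw => ?_)
  refine hAB ⟨heA _ fun i hi => ?_, heB _ fun i hi => ?_⟩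
  · have hwi : w.1.1 i = (ins x t i).1 := congrArg Prod.fst (hw i (by omega))
    rcases hcases i with h | rfl | rfl | h
    · exact .inl (by rw [hwi, hpn i h, hz]; simp [pt, h])
    · right
      rw [hwi, hpn0, hzn]
      exact ⟨ha, (le_max_left e e').trans_lt (h1 x), (h2 x).le⟩
    · exact .inl (by rw [hwi, hpn1, hz]; simp [pt])
    · exact .inl (by rw [hwi, hpn2 i h, hz, hpti (fun i => (p i).1) i h])
  · have hwi : w.2.1 i = (ins x t i).2 := congrArg Prod.snd (hw i (by omega))
    rcases hcases i with h | rfl | rfl | h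
    · exact .inl (by rw [hwi, hpn i h, hz']; simp [pt, h])
    · right
      rw [hwi, hpn0, hzn']
      exact ⟨ha, (le_max_right e e').trans_lt (h4 x), (h5 x).le⟩
    · exact .inl (by rw [hwi, hpn1, hz']; simp [pt])
    · exact .inl (by rw [hwi, hpn2 i h, hz', hpti (fun i => (p i).2) i h])

/-- Pressing down fixes `b` and the side for unboundedly many `a`; the pairs `(a + n, a + n)` then
give the cofinal branching above `(v, v')`. -/
theorem exists_large (hV : IsClopen V) (hn : 1 ≤ n) (hp : IsNode n p) :
    ∃ (b : OmegaOne) (c : Bool), ∀ v v', b < v → v ∉ limitSet → b < v' → v' ∉ limitSet →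
      Large (bif c then V else Vᶜ) (n + 1) (Function.update p n (v, v')) := by
  obtain ⟨b, c, h⟩ := exists_unbounded_of_regressive
    fun a ha => exists_large_of_limit hV hn hp ha
  refine ⟨b, c, fun v v' hv hvl hv' hvl' => .of_forall_exists fun d => ?_⟩
  obtain ⟨a, ha, had, hl⟩ := h (max d (max v v'))
  simp only [max_lt_iff] at had
  refine ⟨addNat a n, had.1.trans_le (le_addNat a n), ?_, hl v v' hv had.2.1 hvl hv' had.2.2 hvl'⟩
  obtain ⟨j, rfl⟩ := Nat.exists_eq_add_of_le' hn
  exact addNat_succ_notMem_limitSet a j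

theorem exists_nonlimit_gt (b : OmegaOne) : ∃ u > b, u ∉ limitSet :=
  ⟨addNat b 1, lt_addNat_one b, addNat_succ_notMem_limitSet b 0⟩

/-- Both properties can be propagated along a branch: `exists_large` gives one side at every child
above `b`, and the other side chooses the child. The limit pair of points then lies in neither `V`
nor `Vᶜ`, since both are open. -/
theorem not_large_and_large_compl (hV : IsClopen V) (hn : 1 ≤ n) (hp : IsNode n p)
    (h1 : Large V n p) (h2 : Large Vᶜ n p) : False := by
  obtain ⟨q, -, hq⟩ := exists_branch
    (P := fun m q => IsNode m q ∧ Large V m q ∧ Large Vᶜ m q)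
    (fun m p q hpq h => ⟨h.1.congr hpq, h.2.1.congr hpq, h.2.2.congr hpq⟩) ⟨hp, h1, h2⟩ (by
      rintro m hm q ⟨hq, hq1, hq2⟩
      obtain ⟨b, c, hc⟩ := exists_large hV (hn.trans hm) hq
      cases c with
      | true =>
        obtain ⟨u, hub, hul, hu⟩ := hq2.exists_child b
        exact ⟨(u, u), hq.update hul hul, hc u u hub hul hub hul, hu⟩
      | false =>
        obtain ⟨u, hub, hul, hu⟩ := hq1.exists_child b
        exact ⟨(u, u), hq.update hul hul, hu, hc u u hub hul hub hul⟩)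
  have hq1 : ∀ i, (q i).1 ∉ limitSet := fun i =>
    ((hq (max n (i + 1)) (le_max_left _ _)).1 i (by omega)).1
  have hq2 : ∀ i, (q i).2 ∉ limitSet := fun i =>
    ((hq (max n (i + 1)) (le_max_left _ _)).1 i (by omega)).2
  by_cases hqV : (ofNonlimit _ hq1, ofNonlimit _ hq2) ∈ V
  · obtain ⟨N, hN⟩ := exists_not_large_compl hV.isOpen hq1 hq2 hqV
    exact hN (max n N) (le_max_right _ _) (hq _ (le_max_left _ _)).2.2
  · obtain ⟨N, hN⟩ := exists_not_large_compl hV.compl.isOpen hq1 hq2 hqV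
    rw [compl_compl] at hN
    exact hN (max n N) (le_max_right _ _) (hq _ (le_max_left _ _)).2.1

/-- If the side in `exists_large` were `Vᶜ`, its children would make `Vᶜ` large at `p`. -/
theorem exists_forall_large (hV : IsClopen V) (hn : 1 ≤ n) (hp : IsNode n p)
    (h : ¬ Large Vᶜ n p) :
    ∃ b : OmegaOne, ∀ v v', b < v → v ∉ limitSet → b < v' → v' ∉ limitSet →
      Large V (n + 1) (Function.update p n (v, v')) := by
  obtain ⟨b, c, hc⟩ := exists_large hV hn hp
  cases c with
  | true => exact ⟨b, hc⟩
  | false =>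
    refine (h (.of_forall_exists fun d => ?_)).elim
    obtain ⟨u, hu, hul⟩ := exists_nonlimit_gt (max b d)
    have hub := (le_max_left b d).trans_lt hu
    exact ⟨u, (le_max_right b d).trans_lt hu, hul, hc u u hub hul hub hul⟩

/-- Since the tree branches by equal pairs, a branch from a diagonal node ends at a diagonal point,
which has a neighbourhood inside `V`. -/
theorem not_large_compl_of_diagonal (hV : IsClopen V) (hdiag : ∀ z, (z, z) ∈ V)
    (hp : IsNode n p) (hpp : ∀ i < n, (p i).1 = (p i).2) : ¬ Large Vᶜ n p := by
  intro h
  obtain ⟨q, -, hq⟩ := exists_branch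
    (P := fun m q => IsNode m q ∧ Large Vᶜ m q ∧ ∀ i < m, (q i).1 = (q i).2)
    (fun m p q hpq h => ⟨h.1.congr hpq, h.2.1.congr hpq, fun i hi => by
      rw [hpq i hi]
      exact h.2.2 i hi⟩) ⟨hp, h, hpp⟩ (by
      rintro m hm q ⟨hq, hq1, hq2⟩
      obtain ⟨u, hub, hul, hu⟩ := hq1.exists_child ⊥
      refine ⟨(u, u), hq.update hul hul, hu, fun i hi => ?_⟩
      rcases Nat.lt_succ_iff_lt_or_eq.1 hi with h' | rfl
      · rw [Function.update_of_ne h'.ne]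
        exact hq2 i h'
      · rw [Function.update_self])
  have hq1 : ∀ i, (q i).1 ∉ limitSet := fun i =>
    ((hq (max n (i + 1)) (le_max_left _ _)).1 i (by omega)).1
  have hq2 : ∀ i, (q i).2 ∉ limitSet := fun i =>
    ((hq (max n (i + 1)) (le_max_left _ _)).1 i (by omega)).2
  have hqq : ofNonlimit _ hq1 = ofNonlimit _ hq2 := Subtype.ext (funext fun i =>
    (hq (max n (i + 1)) (le_max_left _ _)).2.2 i (by omega))
  obtain ⟨N, hN⟩ := exists_not_large_compl hV.isOpen hq1 hq2 (hqq ▸ hdiag _)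
  exact hN (max n N) (le_max_right _ _) (hq _ (le_max_left _ _)).2.1

/-- The diagonal of Kulesza's space is not the intersection of countably many clopen sets. -/
theorem not_forall_isClopen {U : ℕ → Set (KuleszaSpace × KuleszaSpace)}
    (hdiag : ∀ z z', (∀ m, (z, z') ∈ U m) ↔ z = z') : ¬ ∀ m, IsClopen (U m) := by
  intro hU
  have hstep : ∀ n ≥ 1, ∀ p, IsNode n p → (∀ m, ¬ Large (U m)ᶜ n p) →
      ∃ b : OmegaOne, ∀ v v', b < v → v ∉ limitSet → b < v' → v' ∉ limitSet →
        ∀ m, Large (U m) (n + 1) (Function.update p n (v, v')) := by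
    intro n hn p hp h
    choose b hb using fun m => exists_forall_large (hU m) hn hp (h m)
    obtain ⟨d, hd⟩ := exists_gt_of_countable b
    exact ⟨d, fun v v' hv hvl hv' hvl' m =>
      hb m v v' ((hd m).trans hv) hvl ((hd m).trans hv') hvl'⟩
  -- Place 0 is fixed first because a limit term can only occur at a place `n ≥ 1`.
  let p₀ : ℕ → OmegaOne × OmegaOne := fun _ => (⊥, ⊥)
  have hp₀ : IsNode 1 p₀ := fun _ _ => ⟨bot_notMem_limitSet, bot_notMem_limitSet⟩
  obtain ⟨b, hb⟩ := hstep 1 le_rfl p₀ hp₀ fun m =>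
    not_large_compl_of_diagonal (hU m) (fun z => (hdiag z z).2 rfl m) hp₀ fun _ _ => rfl
  -- The only split off the diagonal: `v < v'` at place 1. All later pairs are equal.
  obtain ⟨v, hv, hvl⟩ := exists_nonlimit_gt b
  obtain ⟨v', hv', hvl'⟩ := exists_nonlimit_gt v
  obtain ⟨q, hqp, hq⟩ := exists_branch
    (P := fun m q => IsNode m q ∧ ∀ j, Large (U j) m q)
    (fun m p q hpq h => ⟨h.1.congr hpq, fun j => (h.2 j).congr hpq⟩)
    ⟨hp₀.update hvl hvl', hb v v' hv hvl (hv.trans hv') hvl'⟩ (by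
      rintro m hm q ⟨hq, hql⟩
      obtain ⟨b, hb⟩ := hstep m (by omega) q hq fun j hj =>
        not_large_and_large_compl (hU j) (by omega) hq (hql j) hj
      obtain ⟨u, hu, hul⟩ := exists_nonlimit_gt b
      exact ⟨(u, u), hq.update hul hul, hb u u hu hul hu hul⟩)
  have hq1 : ∀ i, (q i).1 ∉ limitSet := fun i =>
    ((hq (max 2 (i + 1)) (le_max_left _ _)).1 i (by omega)).1
  have hq2 : ∀ i, (q i).2 ∉ limitSet := fun i =>
    ((hq (max 2 (i + 1)) (le_max_left _ _)).1 i (by omega)).2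
  have hne : ofNonlimit _ hq1 ≠ ofNonlimit _ hq2 := fun h => by
    have h1 : (q 1).1 = (q 1).2 := congrFun (congrArg Subtype.val h) 1
    rw [hqp 1 (by omega), Function.update_self] at h1
    exact hv'.ne h1
  rw [Ne, ← hdiag, not_forall] at hne
  obtain ⟨m, hm⟩ := hne
  obtain ⟨N, hN⟩ := exists_not_large_compl (hU m).compl.isOpen hq1 hq2 hm
  rw [compl_compl] at hN
  exact hN (max 2 N) (le_max_right _ _) ((hq _ (le_max_left _ _)).2 m)

/-! ### Consequences for uniformities and topological groups. -/

theorem exists_not_isClosed_of_hasBasis {U : ℕ → Set (KuleszaSpace × KuleszaSpace)}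
    (hU : ∀ n, IsOpen (U n)) (u : UniformSpace KuleszaSpace)
    (hu : u.toTopologicalSpace = kuleszaTopology)
    (hB : (@uniformity KuleszaSpace u).HasBasis (fun _ : ℕ => True) U) :
    ∃ m, ¬ IsClosed (U m) := by
  by_contra! hcl
  refine not_forall_isClopen (U := U) (fun z z' => ⟨fun h => ?_, ?_⟩) fun m => ⟨hcl m, hU m⟩
  · have : @Inseparable _ u.toTopologicalSpace z z' :=
      hB.inseparable_iff_uniformity.2 fun m _ => h m
    rw [hu] at this
    exact this.eq
  · rintro rfl m
    exact refl_mem_uniformity (hB.mem_of_mem trivial)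

/-- Clopen neighbourhoods shrinking to the identity pull back under `(z, z') ↦ (f z)⁻¹ * f z'` to
clopen sets whose intersection is the diagonal. -/
theorem not_isEmbedding_of_group {G : Type*} [Group G] [TopologicalSpace G] [IsTopologicalGroup G]
    [MetrizableSpace G] (hG : smallInductiveDimension G = 0) (f : KuleszaSpace → G) :
    ¬ IsEmbedding f := by
  intro hf
  have hcl : IsTopologicalBasis {s : Set G | IsClopen s} :=
    hasSmallInductiveDimensionLT_one_iff.1 (smallInductiveDimension_le_iff.1 hG.le)
  obtain ⟨B, hB⟩ := (𝓝 (1 : G)).exists_antitone_basis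
  have hW : ∀ n, ∃ W, IsClopen W ∧ (1 : G) ∈ W ∧ W ⊆ B n := fun n => by
    obtain ⟨W, hW, h1, hWB⟩ := hcl.mem_nhds_iff.1 (hB.mem n)
    exact ⟨W, hW, h1, hWB⟩
  choose W hWc hW1 hWB using hW
  have hcont : Continuous fun z : KuleszaSpace × KuleszaSpace => (f z.1)⁻¹ * f z.2 :=
    (hf.continuous.comp continuous_fst).inv.mul (hf.continuous.comp continuous_snd)
  refine not_forall_isClopen (U := fun n => (fun z => (f z.1)⁻¹ * f z.2) ⁻¹' W n)
    (fun z z' => ⟨fun h => ?_, ?_⟩) fun m => (hWc m).preimage hcont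
  · have h1 : (f z)⁻¹ * f z' = 1 := by
      by_contra hne
      obtain ⟨n, -, hn⟩ := hB.1.mem_iff.1 (isOpen_compl_singleton.mem_nhds (Ne.symm hne))
      exact hn (hWB n (h n)) rfl
    exact hf.injective (inv_mul_eq_one.1 h1)
  · rintro rfl m
    simpa using hW1 m

end KuleszaSpace

theorem mainTheorem3 :
    MetrizableSpace KuleszaSpace ∧
    smallInductiveDimension KuleszaSpace = 0 ∧
    (∀ U : ℕ → Set (KuleszaSpace × KuleszaSpace),
      (∀ n, IsOpen (U n)) →
      (∃ u : UniformSpace KuleszaSpace, u.toTopologicalSpace = kuleszaTopology ∧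
        (@uniformity KuleszaSpace u).HasBasis (fun _ : ℕ => True) U) →
      ∃ m, ¬ IsClosed (U m)) ∧
    (∀ (G : Type*) [Group G] [TopologicalSpace G] [IsTopologicalGroup G] [MetrizableSpace G],
      smallInductiveDimension G = 0 →
      ¬ ∃ f : KuleszaSpace → G, IsEmbedding f) :=
  ⟨KuleszaSpace.metrizableSpace, KuleszaSpace.smallInductiveDimension_eq_zero,
    fun _ hU ⟨u, hu, hB⟩ => KuleszaSpace.exists_not_isClosed_of_hasBasis hU u hu hB,
    fun _ _ _ _ _ hG ⟨f, hf⟩ => KuleszaSpace.not_isEmbedding_of_group hG f hf⟩
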